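/- Let $k\ge 0$ be an integer and $n=\binom{k+1}{2}$, and index the coordinates of $\mathbb R^n$ by the edges of the complete graph $K_{k+1}$. Let $\mathcal C=\mathcal C_k$ be the class of the edge sets $S$ of all spanning trees of $K_{k+1}$ (each $S$ has $k$ elements), and let $N=|\mathcal C|$. For $0<\rho<1$ and $S\in\mathcal C$ let $\mathbf A_S$ be the $n\times n$ matrix with $(\mathbf A_S)_{i,i}=1$, $(\mathbf A_S)_{i,j}=\rho$ if $i\ne j$ and $i,j\in S$, and $(\mathbf A_S)_{i,j}=0$ otherwise. Write $\mathbf P_0$ for the law $\mathcal N(0,\mathbf I)$ on $\mathbb R^n$, with expectation $\mathbf E_0$, and $\mathbf P_S$ for the law $\mathcal N(0,\mathbf A_S)$. The average risk of a test $f:\mathbb R^n\to\{0,1\}$ is \[ R(f)=\mathbf P_0\{f(X)=1\}+\frac1N\sum_{S\in\mathcal C}\mathbf P_S\{f(X)=0\}. \] Put $Z_S(x)=\exp\bigl(\tfrac12x^T(\mathbf I-\mathbf A_S^{-1})x\bigr)$ and $L(x)=\frac1N\sum_{S\in\mathcal C}Z_S(x)/\mathbf E_0Z_S$. Let $f^*$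 be the likelihood ratio test, that is, $f^*(x)=0$ if and only if $L(x)\le1$. The Bayes risk is $R^*=R^*(k,\rho):=R(f^*)$. Then: 1. for every $k$ and every $0<\rho\le0.4$, we have $R^*(k,\rho)\ge0.15$; 2. $R^*(k,\rho)\to1$ as $\rho\to0^+$, uniformly in $k$: for every $\varepsilon>0$ there is $\delta\in(0,1]$, independent of $k$, such that $|R^*(k,\rho)-1|<\varepsilon$ for all $k$ and all $0<\rho<\delta$. (Hence $R^*(k_m,\rho_m)\to1$ for any integers $k_m\ge0$ and any $\rho_m\to0^+$, in particular when $k_m\to\infty$.) -/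

import Mathlib

noncomputable section

namespace CorrelationDetection

open MeasureTheory ProbabilityTheory Matrix

section Testing

variable {ι : Type*} [Fintype ι] [DecidableEq ι]

/-- The covariance matrix `A_S`: ones on the diagonal, `ρ` at distinct `i, j ∈ S`, zero elsewhere. -/
def covMat (ρ : ℝ) (S : Finset ι) : Matrix ι ι ℝ :=
  Matrix.of fun i j => if i = j then 1 else if i ∈ S ∧ j ∈ S then ρ else 0

/-- The null distribution `P₀ = N(0, I)`. -/
def nullMeasure (ι : Type*) [Fintype ι] [DecidableEq ι] : Measure (EuclideanSpace ℝ ι) :=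
  multivariateGaussian 0 (1 : Matrix ι ι ℝ)

/-- The alternative distribution `P_S = N(0, A_S)`. -/
def altMeasure (ρ : ℝ) (S : Finset ι) : Measure (EuclideanSpace ℝ ι) :=
  multivariateGaussian 0 (covMat ρ S)

/-- The average risk `R(f) = P₀{f = 1} + (1/N) ∑_{S ∈ C} P_S{f = 0}` of a test `f`. -/
def risk (ρ : ℝ) (C : Finset (Finset ι)) (f : EuclideanSpace ℝ ι → Fin 2) : ℝ :=
  (nullMeasure ι).real {x | f x = 1} +
    (1 / (C.card : ℝ)) * ∑ S ∈ C, (altMeasure ρ S).real {x | f x = 0}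

/-- `Z_S(x) = exp(½ xᵀ (I - A_S⁻¹) x)`. -/
def Zstat (ρ : ℝ) (S : Finset ι) (x : EuclideanSpace ℝ ι) : ℝ :=
  Real.exp ((1 / 2) * (x.ofLp ⬝ᵥ ((1 - (covMat ρ S)⁻¹) *ᵥ x.ofLp)))

/-- The likelihood ratio `L(x) = (1/N) ∑_{S ∈ C} Z_S(x) / E₀ Z_S`. -/
def likelihoodRatio (ρ : ℝ) (C : Finset (Finset ι)) (x : EuclideanSpace ℝ ι) : ℝ :=
  (1 / (C.card : ℝ)) * ∑ S ∈ C, Zstat ρ S x / ∫ y, Zstat ρ S y ∂(nullMeasure ι)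

/-- The likelihood ratio test: `f*(x) = 0` if and only if `L(x) ≤ 1`. -/
def lrTest (ρ : ℝ) (C : Finset (Finset ι)) (x : EuclideanSpace ℝ ι) : Fin 2 :=
  open Classical in if likelihoodRatio ρ C x ≤ 1 then 0 else 1

/-- The Bayes risk `R* = R(f*)`. -/
def bayesRisk (ρ : ℝ) (C : Finset (Finset ι)) : ℝ :=
  risk ρ C (lrTest ρ C)

end Testing

/-- The edges of the complete graph `K_{k+1}` on the vertex set `Fin (k + 1)`. -/
abbrev Edge (k : ℕ) : Type := (⊤ : SimpleGraph (Fin (k + 1))).edgeSet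

/-- The class of (edge sets of) spanning trees of `K_{k+1}`. -/
def spanningTrees (k : ℕ) : Finset (Finset (Edge k)) :=
  open Classical in
  Finset.univ.filter fun S =>
    (SimpleGraph.fromEdgeSet ((Subtype.val : Edge k → Sym2 (Fin (k + 1))) '' (S : Set (Edge k)))).IsTree

end CorrelationDetection

end

noncomputable section

namespace CorrelationDetection

section Trees

namespace SpanningTree

open SimpleGraph

variable {V : Type*}

/-- If `x` is not reachable from `y` then walks from `y` only use edges avoiding `x`. -/
theorem reachable_of_adj_avoiding {G G' : SimpleGraph V} {x y v : V}
    (hxy : ¬ G.Reachable y x) (h : ∀ a b, G.Adj a b → a ≠ x → b ≠ x → G'.Adj a b)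
    (hv : G.Reachable y v) : G'.Reachable y v := by
  rw [reachable_iff_reflTransGen] at hv
  induction hv with
  | refl => rfl
  | @tail b c hb hbc ih =>
    have hb' : G.Reachable y b := (reachable_iff_reflTransGen y b).2 hb
    refine ih.trans (h b c hbc ?_ ?_).reachable
    · rintro rfl; exact hxy hb'
    · rintro rfl; exact hxy (hb'.trans hbc.reachable)

theorem reachable_deleteEdges_or {T : SimpleGraph V} (hT : T.Preconnected) (x y v : V) :
    (T.deleteEdges {s(x, y)}).Reachable y v ∨ (T.deleteEdges {s(x, y)}).Reachable x v := by
  have hv := hT y v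
  rw [reachable_iff_reflTransGen] at hv
  induction hv with
  | refl => left; rfl
  | @tail b c hb hbc ih =>
    by_cases hE : s(b, c) = s(x, y)
    · rcases Sym2.eq_iff.1 hE with ⟨rfl, rfl⟩ | ⟨rfl, rfl⟩
      · left; rfl
      · right; rfl
    · have hadj : (T.deleteEdges {s(x, y)}).Adj b c := by
        rw [deleteEdges_adj]; exact ⟨hbc, by simpa using hE⟩
      exact ih.imp (fun h => h.trans hadj.reachable) (fun h => h.trans hadj.reachable)

/-- Adding an edge between the two sides of a forest with two components yields a tree. -/
theorem isTree_sup_edge {H : SimpleGraph V} (hH : H.IsAcyclic) {x y w : V}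
    (hxy : ¬ H.Reachable x y) (hor : ∀ v, H.Reachable y v ∨ H.Reachable x v)
    (hw : H.Reachable y w) : (H ⊔ edge x w).IsTree := by
  have hxw : ¬ H.Reachable x w := fun h => hxy (h.trans hw.symm)
  have hne : x ≠ w := by rintro rfl; exact hxw (Reachable.refl _)
  have hadj : (H ⊔ edge x w).Adj x w := by simp [edge_adj, hne]
  have hle : H ≤ H ⊔ edge x w := le_sup_left
  have hx : ∀ v, (H ⊔ edge x w).Reachable x v := by
    intro v
    rcases hor v with h | h
    · exact hadj.reachable.trans ((hw.symm.trans h).mono hle)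
    · exact h.mono hle
  refine ⟨?_, hH.sup_edge_of_not_reachable hxw⟩
  exact (connected_iff_exists_forall_reachable _).2 ⟨x, hx⟩

theorem eq_of_sup_edge_eq {H₁ H₂ : SimpleGraph V} {x y w₁ w₂ : V}
    (h₁ : ¬ H₁.Reachable x y) (h₂ : ¬ H₂.Reachable x y)
    (hw₁ : H₁.Reachable y w₁) (hw₂ : H₂.Reachable y w₂)
    (h : H₁ ⊔ edge x w₁ = H₂ ⊔ edge x w₂) : H₁ = H₂ ∧ w₁ = w₂ := by
  have hxw₁ : ¬ H₁.Reachable x w₁ := fun h => h₁ (h.trans hw₁.symm)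
  have hxw₂ : ¬ H₂.Reachable x w₂ := fun h => h₂ (h.trans hw₂.symm)
  have hne₁ : x ≠ w₁ := by rintro rfl; exact hxw₁ (Reachable.refl _)
  have hne₂ : x ≠ w₂ := by rintro rfl; exact hxw₂ (Reachable.refl _)
  have key : ∀ a b, (H₁.Adj a b ∨ (edge x w₁).Adj a b) ↔ (H₂.Adj a b ∨ (edge x w₂).Adj a b) := by
    intro a b
    rw [← sup_adj, ← sup_adj, h]
  have hw : w₁ = w₂ := by
    by_contra hne
    have hadj : H₂.Adj w₁ x := by
      have := (key w₁ x).1 (Or.inr (by simp [edge_adj, hne₁.symm]))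
      simpa [edge_adj, hne, hne₂, hne₁.symm] using this
    have hr : H₂.Reachable y w₁ := by
      refine reachable_of_adj_avoiding (x := x) (fun h => h₁ h.symm) (fun a b hab ha hb => ?_) hw₁
      have := (key a b).1 (Or.inl hab)
      simpa [edge_adj, ha, hb] using this
    exact h₂ (hr.trans hadj.reachable).symm
  subst hw
  refine ⟨?_, rfl⟩
  ext a b
  have hn₁ : H₁.Adj a b → ¬ (edge x w₁).Adj a b := by
    intro hab he
    rw [edge_adj] at he
    rcases he with ⟨⟨rfl, rfl⟩ | ⟨rfl, rfl⟩, -⟩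
    · exact hxw₁ hab.reachable
    · exact hxw₁ hab.symm.reachable
  have hn₂ : H₂.Adj a b → ¬ (edge x w₁).Adj a b := by
    intro hab he
    rw [edge_adj] at he
    rcases he with ⟨⟨rfl, rfl⟩ | ⟨rfl, rfl⟩, -⟩
    · exact hxw₂ hab.reachable
    · exact hxw₂ hab.symm.reachable
  have := key a b
  tauto

theorem deleteEdges_sup_edge {T : SimpleGraph V} {x y : V} (h : T.Adj x y) :
    T.deleteEdges {s(x, y)} ⊔ edge x y = T := by
  ext a b
  rw [sup_adj, deleteEdges_adj, edge_adj, Set.mem_singleton_iff, Sym2.eq_iff]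
  constructor
  · rintro (h' | ⟨⟨rfl, rfl⟩ | ⟨rfl, rfl⟩, -⟩)
    exacts [h'.1, h, h.symm]
  · intro hab
    by_cases hE : a = x ∧ b = y ∨ a = y ∧ b = x
    · exact Or.inr ⟨hE, hab.ne⟩
    · exact Or.inl ⟨hab, hE⟩

/-- Replace the edge `xy` of `T` by an edge joining `w` to whichever of `x`, `y` lies on the other
side. -/
def swapEdge (T : SimpleGraph V) (x y w : V) : SimpleGraph V :=
  open Classical in
  if (T.deleteEdges {s(x, y)}).Reachable y w then T.deleteEdges {s(x, y)} ⊔ edge x w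
  else T.deleteEdges {s(x, y)} ⊔ edge y w

theorem not_reachable_deleteEdges {T : SimpleGraph V} (hT : T.IsTree) {x y : V} (h : T.Adj x y) :
    ¬ (T.deleteEdges {s(x, y)}).Reachable x y :=
  isBridge_iff.1 (isAcyclic_iff_forall_isBridge.1 hT.isAcyclic ((mem_edgeSet T).2 h))

theorem isTree_swapEdge {T : SimpleGraph V} (hT : T.IsTree) {x y : V} (h : T.Adj x y) (w : V) :
    (swapEdge T x y w).IsTree := by
  have hor := reachable_deleteEdges_or hT.connected.preconnected x y
  have hac : (T.deleteEdges {s(x, y)}).IsAcyclic := hT.isAcyclic.anti (deleteEdges_le _)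
  have hn := not_reachable_deleteEdges hT h
  unfold swapEdge
  split_ifs with hw
  · exact isTree_sup_edge hac hn hor hw
  · exact isTree_sup_edge hac (fun h => hn h.symm) (fun v => (hor v).symm)
      ((hor w).resolve_left hw)

theorem deleteEdges_le_swapEdge (T : SimpleGraph V) (x y w : V) :
    T.deleteEdges {s(x, y)} ≤ swapEdge T x y w := by
  unfold swapEdge
  split_ifs
  exacts [le_sup_left, le_sup_left]

theorem swapEdge_injective {T₁ T₂ : SimpleGraph V} (hT₁ : T₁.IsTree) (hT₂ : T₂.IsTree) {x y : V}
    (h₁ : T₁.Adj x y) (h₂ : T₂.Adj x y) {w₁ w₂ : V}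
    (hiff : (T₁.deleteEdges {s(x, y)}).Reachable y w₁ ↔
      (T₂.deleteEdges {s(x, y)}).Reachable y w₂)
    (h : swapEdge T₁ x y w₁ = swapEdge T₂ x y w₂) : T₁ = T₂ ∧ w₁ = w₂ := by
  have hn₁ := not_reachable_deleteEdges hT₁ h₁
  have hn₂ := not_reachable_deleteEdges hT₂ h₂
  have : T₁.deleteEdges {s(x, y)} = T₂.deleteEdges {s(x, y)} ∧ w₁ = w₂ := by
    unfold swapEdge at h
    by_cases hw₁ : (T₁.deleteEdges {s(x, y)}).Reachable y w₁
    · have hw₂ := hiff.1 hw₁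
      rw [if_pos hw₁, if_pos hw₂] at h
      exact eq_of_sup_edge_eq hn₁ hn₂ hw₁ hw₂ h
    · have hw₂ := fun h => hw₁ (hiff.2 h)
      rw [if_neg hw₁, if_neg hw₂] at h
      exact eq_of_sup_edge_eq (fun h => hn₁ h.symm) (fun h => hn₂ h.symm)
        ((reachable_deleteEdges_or hT₁.connected.preconnected x y w₁).resolve_left hw₁)
        ((reachable_deleteEdges_or hT₂.connected.preconnected x y w₂).resolve_left hw₂) h
  refine ⟨?_, this.2⟩
  rw [← deleteEdges_sup_edge h₁, ← deleteEdges_sup_edge h₂, this.1]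

/-- The trees on `V` containing all edges in `J`. -/
def treesContaining [Finite V] (J : Set (Sym2 V)) : Finset (SimpleGraph V) :=
  (Set.toFinite {T : SimpleGraph V | T.IsTree ∧ J ⊆ T.edgeSet}).toFinset

theorem mem_treesContaining [Finite V] {J : Set (Sym2 V)} {T : SimpleGraph V} :
    T ∈ treesContaining J ↔ T.IsTree ∧ J ⊆ T.edgeSet := by
  simp [treesContaining]

/-- Prescribing one more edge reduces the number of trees by a factor of at least `|V| / 2`. -/
theorem card_treesContaining_insert_le [Fintype V] (J : Set (Sym2 V)) (e : Sym2 V) (he : e ∉ J) :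
    Fintype.card V * (treesContaining (insert e J)).card ≤ 2 * (treesContaining J).card := by
  classical
  induction e with
  | h x y =>
  have hcard := Finset.card_le_card_of_injOn
    (s := treesContaining (insert s(x, y) J) ×ˢ (Finset.univ : Finset V))
    (t := treesContaining J ×ˢ (Finset.univ : Finset Bool))
    (fun p => (swapEdge p.1 x y p.2,
      decide ((p.1.deleteEdges {s(x, y)}).Reachable y p.2))) ?_ ?_
  · simpa [mul_comm] using hcard
  · rintro ⟨T, w⟩ hT
    simp only [Finset.coe_product, Finset.coe_univ, Set.mem_prod, Finset.mem_coe,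
      mem_treesContaining, Set.insert_subset_iff, mem_edgeSet, Set.mem_univ, and_true] at hT ⊢
    refine ⟨isTree_swapEdge hT.1 hT.2.1 w, fun f hf => ?_⟩
    refine edgeSet_mono (deleteEdges_le_swapEdge T x y w) ?_
    rw [edgeSet_deleteEdges]
    refine ⟨hT.2.2 hf, ?_⟩
    rintro rfl
    exact he hf
  · rintro ⟨T₁, w₁⟩ hT₁ ⟨T₂, w₂⟩ hT₂ heq
    simp only [Finset.coe_product, Finset.coe_univ, Set.mem_prod, Finset.mem_coe,
      mem_treesContaining, Set.insert_subset_iff, mem_edgeSet, Set.mem_univ, and_true] at hT₁ hT₂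
    simp only [Prod.mk.injEq, decide_eq_decide] at heq ⊢
    exact swapEdge_injective hT₁.1 hT₂.1 hT₁.2.1 hT₂.2.1 heq.2 heq.1

end SpanningTree

open SimpleGraph SpanningTree

/-- The graph spanned by a set of edges. -/
abbrev edgeGraph {k : ℕ} (S : Finset (Edge k)) : SimpleGraph (Fin (k + 1)) :=
  fromEdgeSet ((Subtype.val : Edge k → Sym2 (Fin (k + 1))) '' (S : Set (Edge k)))

theorem edgeSet_edgeGraph {k : ℕ} (S : Finset (Edge k)) :
    (edgeGraph S).edgeSet = Subtype.val '' (S : Set (Edge k)) := by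
  rw [edgeSet_fromEdgeSet, sdiff_eq_left, Set.disjoint_left]
  rintro _ ⟨e, -, rfl⟩ he
  have := e.2
  simp only [edgeSet_top, Set.mem_compl_iff] at this
  exact this he

theorem edgeGraph_injective {k : ℕ} :
    Function.Injective (edgeGraph : Finset (Edge k) → SimpleGraph (Fin (k + 1))) := by
  intro S T h
  have := congrArg edgeSet h
  rw [edgeSet_edgeGraph, edgeSet_edgeGraph] at this
  exact Finset.coe_injective (Subtype.val_injective.image_injective this)

theorem exists_edgeGraph_eq {k : ℕ} (T : SimpleGraph (Fin (k + 1))) :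
    ∃ S : Finset (Edge k), edgeGraph S = T := by
  classical
  refine ⟨Finset.univ.filter fun e => e.1 ∈ T.edgeSet, ?_⟩
  rw [← edgeSet_inj, edgeSet_edgeGraph]
  ext e
  simp only [Finset.coe_filter, Finset.mem_univ, true_and, Set.mem_image, Set.mem_ofPred_eq,
    Subtype.exists, exists_and_left, exists_prop, exists_eq_right_right, and_iff_left_iff_imp]
  exact fun h => edgeSet_mono le_top h

theorem mem_spanningTrees {k : ℕ} {S : Finset (Edge k)} :
    S ∈ spanningTrees k ↔ (edgeGraph S).IsTree := by
  simp [spanningTrees]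

theorem spanningTrees_nonempty (k : ℕ) : (spanningTrees k).Nonempty := by
  obtain ⟨T, -, hT⟩ := (connected_top (V := Fin (k + 1))).exists_isTree_le
  obtain ⟨S, rfl⟩ := exists_edgeGraph_eq T
  exact ⟨S, mem_spanningTrees.2 hT⟩

theorem card_of_mem_spanningTrees {k : ℕ} {S : Finset (Edge k)} (hS : S ∈ spanningTrees k) :
    S.card = k := by
  have h := (isTree_iff_connected_and_card.1 (mem_spanningTrees.1 hS)).2
  rw [edgeSet_edgeGraph, Nat.card_image_of_injective Subtype.val_injective] at h
  simpa using h

theorem card_filter_subset_eq {k : ℕ} (J : Finset (Edge k)) [DecidableEq (Edge k)] :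
    ((spanningTrees k).filter fun S => J ⊆ S).card =
      (treesContaining (Subtype.val '' (J : Set (Edge k)))).card := by
  refine Finset.card_bij (fun S _ => edgeGraph S) ?_ (fun _ _ _ _ h => edgeGraph_injective h) ?_
  · intro S hS
    rw [Finset.mem_filter, mem_spanningTrees] at hS
    rw [mem_treesContaining, edgeSet_edgeGraph]
    exact ⟨hS.1, Set.image_mono (Finset.coe_subset.2 hS.2)⟩
  · intro T hT
    obtain ⟨S, rfl⟩ := exists_edgeGraph_eq T
    rw [mem_treesContaining, edgeSet_edgeGraph,
      Set.image_subset_image_iff Subtype.val_injective, Finset.coe_subset] at hT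
    exact ⟨S, Finset.mem_filter.2 ⟨mem_spanningTrees.2 hT.1, hT.2⟩, rfl⟩

/-- Negative correlation of the edges of a uniform spanning tree. -/
theorem card_filter_subset_le {k : ℕ} [DecidableEq (Edge k)] (J : Finset (Edge k)) :
    (((spanningTrees k).filter fun S => J ⊆ S).card : ℝ) ≤
      (2 / (k + 1 : ℝ)) ^ J.card * (spanningTrees k).card := by
  induction J using Finset.induction_on with
  | empty => simp
  | @insert e J he ih =>
    have h := card_treesContaining_insert_le (Subtype.val '' (J : Set (Edge k))) e.1
      (by rintro ⟨f, hf, hfe⟩; exact he (Subtype.ext hfe ▸ hf))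
    rw [← Set.image_insert_eq, ← Finset.coe_insert, ← card_filter_subset_eq,
      ← card_filter_subset_eq, Fintype.card_fin] at h
    have h' : ((k : ℝ) + 1) * (((spanningTrees k).filter fun S => insert e J ⊆ S).card : ℝ) ≤
        2 * (((spanningTrees k).filter fun S => J ⊆ S).card : ℝ) := by exact_mod_cast h
    rw [Finset.card_insert_of_notMem he, pow_succ]
    have hk : (0 : ℝ) < k + 1 := by positivity
    calc (((spanningTrees k).filter fun S => insert e J ⊆ S).card : ℝ)
        ≤ 2 / (k + 1 : ℝ) * (((spanningTrees k).filter fun S => J ⊆ S).card : ℝ) := by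
          rw [div_mul_eq_mul_div, le_div_iff₀ hk]; linarith
      _ ≤ 2 / (k + 1 : ℝ) * ((2 / (k + 1 : ℝ)) ^ J.card * (spanningTrees k).card) := by gcongr
      _ = _ := by ring

theorem sum_pow_card_inter_le {k : ℕ} [DecidableEq (Edge k)] {t : ℝ} (ht : 0 ≤ t)
    {S' : Finset (Edge k)} (hS' : S' ∈ spanningTrees k) :
    ∑ S ∈ spanningTrees k, (1 + t) ^ (S ∩ S').card ≤
      (spanningTrees k).card * Real.exp (2 * t) := by
  have hpow : ∀ S : Finset (Edge k), (1 + t) ^ (S ∩ S').card =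
      ∑ J ∈ S'.powerset, if J ⊆ S then t ^ J.card else 0 := by
    intro S
    rw [← Finset.sum_filter, add_comm, ← Finset.sum_pow_mul_eq_add_pow]
    simp only [one_pow, mul_one]
    refine Finset.sum_congr ?_ fun _ _ => rfl
    ext J
    simp only [Finset.mem_powerset, Finset.mem_filter, Finset.subset_inter_iff]
    tauto
  have hk : (0 : ℝ) < k + 1 := by positivity
  calc ∑ S ∈ spanningTrees k, (1 + t) ^ (S ∩ S').card
      = ∑ J ∈ S'.powerset, t ^ J.card * ((spanningTrees k).filter fun S => J ⊆ S).card := by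
        simp_rw [hpow]
        rw [Finset.sum_comm]
        refine Finset.sum_congr rfl fun J _ => ?_
        rw [← Finset.sum_filter, Finset.sum_const, nsmul_eq_mul, mul_comm]
    _ ≤ ∑ J ∈ S'.powerset, t ^ J.card *
          ((2 / (k + 1 : ℝ)) ^ J.card * (spanningTrees k).card) := by
        gcongr with J hJ
        exact card_filter_subset_le J
    _ = (spanningTrees k).card * (t * (2 / (k + 1 : ℝ)) + 1) ^ k := by
        have h := Finset.sum_pow_mul_eq_add_pow (t * (2 / (k + 1 : ℝ))) 1 S'
        rw [card_of_mem_spanningTrees hS'] at h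
        rw [← h, Finset.mul_sum]
        refine Finset.sum_congr rfl fun J _ => ?_
        rw [mul_pow, one_pow]; ring
    _ ≤ (spanningTrees k).card * Real.exp (2 * t) := by
        gcongr
        calc (t * (2 / (k + 1 : ℝ)) + 1) ^ k ≤ (Real.exp (t * (2 / (k + 1 : ℝ)))) ^ k := by
              gcongr; exact Real.add_one_le_exp _
          _ = Real.exp (k * (t * (2 / (k + 1 : ℝ)))) := by rw [← Real.exp_nat_mul]
          _ ≤ Real.exp (2 * t) := by
              refine Real.exp_le_exp.2 ?_
              have : (k : ℝ) / (k + 1) ≤ 1 := by rw [div_le_one hk]; linarith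
              calc (k : ℝ) * (t * (2 / (k + 1))) = (k / (k + 1)) * (2 * t) := by ring
                _ ≤ 1 * (2 * t) := by gcongr
                _ = 2 * t := one_mul _

end Trees

section Densities

open MeasureTheory ProbabilityTheory Matrix

/-- The density of `N(√ρ u, 1 - ρ)` with respect to `N(0, 1)`. -/
def coordLR (ρ u s : ℝ) : ℝ :=
  (√(1 - ρ))⁻¹ * Real.exp (s ^ 2 / 2 - (s - √ρ * u) ^ 2 / (2 * (1 - ρ)))

theorem coordLR_pos {ρ : ℝ} (hρ : ρ < 1) (u s : ℝ) : 0 < coordLR ρ u s :=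
  mul_pos (inv_pos.2 (Real.sqrt_pos.2 (by linarith))) (Real.exp_pos _)

@[fun_prop]
theorem continuous_coordLR (ρ : ℝ) : Continuous fun p : ℝ × ℝ => coordLR ρ p.1 p.2 := by
  unfold coordLR
  fun_prop

theorem gaussianPDFReal_mul_coordLR {ρ : ℝ} (hρ : ρ < 1) (u s : ℝ) :
    gaussianPDFReal 0 1 s * coordLR ρ u s =
      gaussianPDFReal (√ρ * u) (Real.toNNReal (1 - ρ)) s := by
  have h1 : 0 < 1 - ρ := by linarith
  rw [gaussianPDFReal, gaussianPDFReal, coordLR, Real.coe_toNNReal _ h1.le,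
    Real.sqrt_mul (by positivity) (1 - ρ), mul_inv, NNReal.coe_one, mul_one]
  rw [show ∀ a b c d : ℝ, a * b * (c * d) = a * c * (b * d) by intros; ring, ← Real.exp_add]
  congr 2
  ring

theorem integral_coordLR_smul {E : Type*} [NormedAddCommGroup E] [NormedSpace ℝ E] {ρ : ℝ}
    (hρ : ρ < 1) (u : ℝ) (g : ℝ → E) :
    ∫ s, coordLR ρ u s • g s ∂(gaussianReal 0 1) =
      ∫ s, g s ∂(gaussianReal (√ρ * u) (Real.toNNReal (1 - ρ))) := by
  have h1 : Real.toNNReal (1 - ρ) ≠ 0 := by simpa using hρ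
  rw [integral_gaussianReal_eq_integral_smul one_ne_zero,
    integral_gaussianReal_eq_integral_smul h1]
  simp_rw [smul_smul, gaussianPDFReal_mul_coordLR hρ]

theorem integral_coordLR {ρ : ℝ} (hρ : ρ < 1) (u : ℝ) :
    ∫ s, coordLR ρ u s ∂(gaussianReal 0 1) = 1 := by
  simpa using integral_coordLR_smul hρ u (fun _ => (1 : ℝ))

theorem integrable_coordLR {ρ : ℝ} (hρ : ρ < 1) (u : ℝ) :
    Integrable (coordLR ρ u) (gaussianReal 0 1) := by
  by_contra h
  simpa [integral_undef h] using integral_coordLR hρ u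

/-- The second moment of `coordLR ρ u`. -/
def secondMoment (ρ u : ℝ) : ℝ := Real.exp (ρ * u ^ 2 / (1 + ρ)) / √(1 - ρ ^ 2)

theorem gaussianPDFReal_mul_coordLR_sq {ρ : ℝ} (hρ₀ : 0 ≤ ρ) (hρ : ρ < 1) (u s : ℝ) :
    gaussianPDFReal 0 1 s * coordLR ρ u s ^ 2 = secondMoment ρ u *
      gaussianPDFReal (2 * √ρ * u / (1 + ρ)) (Real.toNNReal ((1 - ρ) / (1 + ρ))) s := by
  have h1 : 0 < 1 - ρ := by linarith
  have h2 : 0 < 1 + ρ := by linarith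
  have hsq : √ρ ^ 2 = ρ := Real.sq_sqrt hρ₀
  rw [gaussianPDFReal, gaussianPDFReal, coordLR, secondMoment,
    Real.coe_toNNReal _ (by positivity),
    Real.sqrt_mul (by positivity) ((1 - ρ) / (1 + ρ)), mul_inv, NNReal.coe_one, mul_one,
    show 1 - ρ ^ 2 = (1 - ρ) * (1 + ρ) by ring, Real.sqrt_mul h1.le, Real.sqrt_div h1.le, mul_pow,
    ← Real.exp_nat_mul]
  have hr1 : 0 < √(1 - ρ) := Real.sqrt_pos.2 h1
  have hr2 : 0 < √(1 + ρ) := Real.sqrt_pos.2 h2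
  have hexp : Real.exp (-(s - 0) ^ 2 / 2) *
      Real.exp ((2 : ℕ) * (s ^ 2 / 2 - (s - √ρ * u) ^ 2 / (2 * (1 - ρ)))) =
      Real.exp (ρ * u ^ 2 / (1 + ρ)) *
        Real.exp (-(s - 2 * √ρ * u / (1 + ρ)) ^ 2 / (2 * ((1 - ρ) / (1 + ρ)))) := by
    rw [← Real.exp_add, ← Real.exp_add]
    congr 1
    push_cast
    field_simp
    ring_nf
    rw [hsq]
    ring
  calc _ = (√(2 * Real.pi))⁻¹ * ((√(1 - ρ))⁻¹) ^ 2 * (Real.exp (-(s - 0) ^ 2 / 2) *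
      Real.exp ((2 : ℕ) * (s ^ 2 / 2 - (s - √ρ * u) ^ 2 / (2 * (1 - ρ))))) := by ring_nf
    _ = _ := by
      rw [hexp]
      field_simp

theorem integral_coordLR_sq {ρ : ℝ} (hρ₀ : 0 ≤ ρ) (hρ : ρ < 1) (u : ℝ) :
    ∫ s, coordLR ρ u s ^ 2 ∂(gaussianReal 0 1) = secondMoment ρ u := by
  have h1 : Real.toNNReal ((1 - ρ) / (1 + ρ)) ≠ 0 := by
    have : 0 < (1 - ρ) / (1 + ρ) := div_pos (by linarith) (by linarith)
    simpa using this
  rw [integral_gaussianReal_eq_integral_smul one_ne_zero]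
  simp_rw [smul_eq_mul, gaussianPDFReal_mul_coordLR_sq hρ₀ hρ]
  rw [integral_const_mul, integral_gaussianPDFReal_eq_one _ h1, mul_one]

theorem secondMoment_pos {ρ : ℝ} (hρ₀ : 0 ≤ ρ) (hρ : ρ < 1) (u : ℝ) : 0 < secondMoment ρ u :=
  div_pos (Real.exp_pos _) (Real.sqrt_pos.2 (by nlinarith))

theorem integrable_coordLR_sq {ρ : ℝ} (hρ₀ : 0 ≤ ρ) (hρ : ρ < 1) (u : ℝ) :
    Integrable (fun s => coordLR ρ u s ^ 2) (gaussianReal 0 1) := by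
  by_contra h
  have := integral_coordLR_sq hρ₀ hρ u
  rw [integral_undef h] at this
  exact (secondMoment_pos hρ₀ hρ u).ne this

variable {ι : Type*}

/-- The density with respect to `P₀` of the law of a Gaussian vector with independent coordinates,
distributed as `N(√ρ u, 1 - ρ)` on `S` and as `N(0, 1)` off `S`. -/
def shiftLR (ρ : ℝ) (S : Finset ι) (u : ℝ) (x : EuclideanSpace ℝ ι) : ℝ :=
  ∏ i ∈ S, coordLR ρ u (x i)

theorem shiftLR_pos {ρ : ℝ} (hρ : ρ < 1) (S : Finset ι) (u : ℝ) (x : EuclideanSpace ℝ ι) :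
    0 < shiftLR ρ S u x :=
  Finset.prod_pos fun _ _ => coordLR_pos hρ _ _

theorem continuous_shiftLR (ρ : ℝ) (S : Finset ι) :
    Continuous fun p : ℝ × EuclideanSpace ℝ ι => shiftLR ρ S p.1 p.2 := by
  unfold shiftLR
  refine continuous_finsetProd _ fun i _ => ?_
  exact (continuous_coordLR ρ).comp (by fun_prop : Continuous fun p : ℝ × EuclideanSpace ℝ ι =>
    (p.1, p.2 i))

variable [Fintype ι]

theorem inner_eq_sum (x t : EuclideanSpace ℝ ι) : inner ℝ x t = ∑ i, x i * t i := by
  simp [PiLp.inner_apply, mul_comm]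

variable [DecidableEq ι]

theorem nullMeasure_eq_map : nullMeasure ι =
    (Measure.pi fun _ : ι => gaussianReal 0 1).map (MeasurableEquiv.toLp 2 (ι → ℝ)) := by
  rw [nullMeasure, multivariateGaussian_zero_one, ← map_pi_eq_stdGaussian]
  rfl

instance : IsProbabilityMeasure (nullMeasure ι) := by
  unfold nullMeasure; infer_instance

theorem integral_nullMeasure_prod {𝕜 : Type*} [RCLike 𝕜] (f : ι → ℝ → 𝕜) :
    ∫ x, ∏ i, f i (x i) ∂(nullMeasure ι) = ∏ i, ∫ s, f i s ∂(gaussianReal 0 1) := by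
  rw [nullMeasure_eq_map, integral_map_equiv, ← integral_fintype_prod_eq_prod]
  rfl

theorem integrable_nullMeasure_prod {𝕜 : Type*} [RCLike 𝕜] {f : ι → ℝ → 𝕜}
    (hf : ∀ i, Integrable (f i) (gaussianReal 0 1)) :
    Integrable (fun x : EuclideanSpace ℝ ι => ∏ i, f i (x i)) (nullMeasure ι) := by
  rw [nullMeasure_eq_map, integrable_map_equiv]
  exact Integrable.fintype_prod hf

theorem shiftLR_eq_prod (ρ : ℝ) (S : Finset ι) (u : ℝ) (x : EuclideanSpace ℝ ι) :
    shiftLR ρ S u x = ∏ i, if i ∈ S then coordLR ρ u (x i) else 1 := by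
  rw [shiftLR, Finset.prod_ite_mem, Finset.univ_inter]

theorem integrable_shiftLR {ρ : ℝ} (hρ : ρ < 1) (S : Finset ι) (u : ℝ) :
    Integrable (shiftLR ρ S u) (nullMeasure ι) := by
  simp_rw [funext (shiftLR_eq_prod ρ S u)]
  refine integrable_nullMeasure_prod (f := fun i s => if i ∈ S then coordLR ρ u s else 1) ?_
  intro i
  split_ifs
  exacts [integrable_coordLR hρ u, integrable_const _]

theorem integral_shiftLR {ρ : ℝ} (hρ : ρ < 1) (S : Finset ι) (u : ℝ) :
    ∫ x, shiftLR ρ S u x ∂(nullMeasure ι) = 1 := by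
  simp_rw [shiftLR_eq_prod]
  rw [integral_nullMeasure_prod (fun i s => if i ∈ S then coordLR ρ u s else 1)]
  refine Finset.prod_eq_one fun i _ => ?_
  split_ifs
  exacts [integral_coordLR hρ u, by simp]

theorem shiftLR_mul_eq_prod (ρ : ℝ) (S T : Finset ι) (u : ℝ) (x : EuclideanSpace ℝ ι) :
    shiftLR ρ S u x * shiftLR ρ T u x =
      ∏ i, (if i ∈ S ∩ T then coordLR ρ u (x i) ^ 2 else
        if i ∈ S ∪ T then coordLR ρ u (x i) else 1) := by
  rw [shiftLR_eq_prod, shiftLR_eq_prod, ← Finset.prod_mul_distrib]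
  refine Finset.prod_congr rfl fun i _ => ?_
  by_cases hS : i ∈ S <;> by_cases hT : i ∈ T <;> simp [hS, hT, sq]

theorem integrable_shiftLR_mul {ρ : ℝ} (hρ₀ : 0 ≤ ρ) (hρ : ρ < 1) (S T : Finset ι) (u : ℝ) :
    Integrable (fun x => shiftLR ρ S u x * shiftLR ρ T u x) (nullMeasure ι) := by
  simp_rw [shiftLR_mul_eq_prod]
  refine integrable_nullMeasure_prod (f := fun i s => if i ∈ S ∩ T then coordLR ρ u s ^ 2 else
        if i ∈ S ∪ T then coordLR ρ u s else 1) ?_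
  intro i
  split_ifs
  exacts [integrable_coordLR_sq hρ₀ hρ u, integrable_coordLR hρ u, integrable_const _]

theorem integral_shiftLR_mul {ρ : ℝ} (hρ₀ : 0 ≤ ρ) (hρ : ρ < 1) (S T : Finset ι) (u : ℝ) :
    ∫ x, shiftLR ρ S u x * shiftLR ρ T u x ∂(nullMeasure ι) =
      secondMoment ρ u ^ (S ∩ T).card := by
  simp_rw [shiftLR_mul_eq_prod]
  rw [integral_nullMeasure_prod (fun i s => if i ∈ S ∩ T then coordLR ρ u s ^ 2 else
        if i ∈ S ∪ T then coordLR ρ u s else 1), ← Finset.prod_const, ← Finset.univ_inter (S ∩ T),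
        ← Finset.prod_ite_mem]
  refine Finset.prod_congr rfl fun i _ => ?_
  rw [Finset.univ_inter]
  split_ifs
  exacts [integral_coordLR_sq hρ₀ hρ u, integral_coordLR hρ u, by simp]

theorem integrable_shiftLR_prod {ρ : ℝ} (hρ : ρ < 1) (S : Finset ι) :
    Integrable (fun p : ℝ × EuclideanSpace ℝ ι => shiftLR ρ S p.1 p.2)
      ((gaussianReal 0 1).prod (nullMeasure ι)) := by
  rw [integrable_prod_iff (continuous_shiftLR ρ S).aestronglyMeasurable]
  refine ⟨ae_of_all _ fun u => integrable_shiftLR hρ S u, ?_⟩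
  simp_rw [Real.norm_of_nonneg (shiftLR_pos hρ S _ _).le, integral_shiftLR hρ]
  exact integrable_const _

theorem covMat_eq {ι : Type*} [DecidableEq ι] (ρ : ℝ) (S : Finset ι) : covMat ρ S =
    diagonal (fun i => if i ∈ S then 1 - ρ else 1) +
      ρ • vecMulVec (fun i => if i ∈ S then 1 else 0) (fun i => if i ∈ S then 1 else 0) := by
  ext i j
  simp only [covMat, of_apply, Matrix.add_apply, Matrix.smul_apply, vecMulVec_apply, diagonal_apply]
  by_cases hij : i = j
  · subst hij
    by_cases hi : i ∈ S <;> simp [hi]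
  · by_cases hi : i ∈ S <;> by_cases hj : j ∈ S <;> simp [hi, hj, hij]

theorem posSemidef_covMat {ρ : ℝ} (hρ₀ : 0 ≤ ρ) (hρ : ρ < 1) (S : Finset ι) :
    (covMat ρ S).PosSemidef := by
  rw [covMat_eq]
  refine PosSemidef.add (PosSemidef.diagonal fun i => ?_) (PosSemidef.smul ?_ hρ₀)
  · dsimp only [Pi.zero_apply]
    split_ifs <;> linarith
  · simpa using posSemidef_vecMulVec_self_star (R := ℝ) (fun i => if i ∈ S then (1 : ℝ) else 0)

theorem dotProduct_covMat (ρ : ℝ) (S : Finset ι) (t : ι → ℝ) :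
    t ⬝ᵥ covMat ρ S *ᵥ t =
      ∑ i, (if i ∈ S then 1 - ρ else 1) * t i ^ 2 + ρ * (∑ i ∈ S, t i) ^ 2 := by
  rw [covMat_eq, add_mulVec, dotProduct_add, smul_mulVec, dotProduct_smul, vecMulVec_mulVec]
  congr 1
  · simp only [dotProduct, mulVec_diagonal]
    exact Finset.sum_congr rfl fun i _ => by ring
  · simp [dotProduct, Finset.sum_ite_mem, sq, ← Finset.sum_mul]

theorem integral_shiftLR_smul_exp {ρ : ℝ} (hρ : ρ < 1) (S : Finset ι) (u : ℝ)
    (t : EuclideanSpace ℝ ι) :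
    ∫ x, shiftLR ρ S u x • Complex.exp (inner ℝ x t * Complex.I) ∂(nullMeasure ι) =
      Complex.exp (((√ρ * ∑ i ∈ S, t i : ℝ) : ℂ) * u * Complex.I) *
        Complex.exp (-((∑ i, (if i ∈ S then 1 - ρ else 1) * t i ^ 2 : ℝ) : ℂ) / 2) := by
  have h : ∀ x : EuclideanSpace ℝ ι,
      shiftLR ρ S u x • Complex.exp (inner ℝ x t * Complex.I) =
      ∏ i, (if i ∈ S then coordLR ρ u (x i) else 1) • Complex.exp (t i * x i * Complex.I) := by
    intro x
    simp_rw [shiftLR_eq_prod, inner_eq_sum, Complex.real_smul, Finset.prod_mul_distrib,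
      ← Complex.exp_sum, ← Finset.sum_mul]
    push_cast
    simp only [mul_comm]
  simp_rw [h]
  rw [integral_nullMeasure_prod
    (fun i s => (if i ∈ S then coordLR ρ u s else 1) • Complex.exp (t i * s * Complex.I))]
  have h' : ∀ i, ∫ s, (if i ∈ S then coordLR ρ u s else 1) •
        Complex.exp (t i * s * Complex.I) ∂(gaussianReal 0 1) =
      Complex.exp ((if i ∈ S then ((√ρ * t i : ℝ) : ℂ) else 0) * u * Complex.I +
        -(((if i ∈ S then 1 - ρ else 1) * t i ^ 2 : ℝ) : ℂ) / 2) := by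
    intro i
    split_ifs with hi
    · rw [integral_coordLR_smul hρ, ← charFun_apply_real, charFun_gaussianReal,
        Real.coe_toNNReal _ (by linarith)]
      congr 1
      push_cast
      ring
    · simp_rw [one_smul]
      rw [← charFun_apply_real, charFun_gaussianReal]
      congr 1
      push_cast
      ring
  simp_rw [h']
  rw [← Complex.exp_sum, ← Complex.exp_add, Finset.sum_add_distrib, ← Finset.sum_mul,
    ← Finset.sum_mul, Finset.sum_ite_mem, Finset.univ_inter, ← Finset.sum_div,
    Finset.sum_neg_distrib, Finset.mul_sum, Complex.ofReal_sum, Complex.ofReal_sum]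

/-- `P_S` is a Gaussian mixture of the shifted laws. -/
theorem altMeasure_eq_map_snd {ρ : ℝ} (hρ₀ : 0 ≤ ρ) (hρ : ρ < 1) (S : Finset ι) :
    altMeasure ρ S = (((gaussianReal 0 1).prod (nullMeasure ι)).withDensity
      fun p => ENNReal.ofReal (shiftLR ρ S p.1 p.2)).map Prod.snd := by
  have hint := integrable_shiftLR_prod hρ S
  have hfin : IsFiniteMeasure (((gaussianReal 0 1).prod (nullMeasure ι)).withDensity
      fun p => ENNReal.ofReal (shiftLR ρ S p.1 p.2)) :=
    isFiniteMeasure_withDensity_ofReal hint.2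
  have hfin' : IsFiniteMeasure (altMeasure ρ S) := by unfold altMeasure; infer_instance
  refine Measure.ext_of_charFun (funext fun t => ?_)
  have hmeas : Measurable fun p : ℝ × EuclideanSpace ℝ ι =>
      ENNReal.ofReal (shiftLR ρ S p.1 p.2) := (continuous_shiftLR ρ S).measurable.ennreal_ofReal
  rw [altMeasure, charFun_multivariateGaussian (posSemidef_covMat hρ₀ hρ S), charFun_apply,
    integral_map (by fun_prop) (Continuous.aestronglyMeasurable (by fun_prop)),
    integral_withDensity_eq_integral_toReal_smul hmeas (ae_of_all _ fun _ => ENNReal.ofReal_lt_top)]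
  simp_rw [ENNReal.toReal_ofReal (shiftLR_pos hρ S _ _).le]
  rw [integral_prod]
  · simp_rw [integral_shiftLR_smul_exp hρ]
    rw [integral_mul_const, ← charFun_apply_real, charFun_gaussianReal, ← Complex.exp_add,
      dotProduct_covMat]
    congr 1
    have hsq : (√ρ : ℂ) ^ 2 = ρ := by exact_mod_cast Real.sq_sqrt hρ₀
    simp only [inner_zero_right, Complex.ofReal_zero, zero_mul, mul_zero, zero_sub,
      NNReal.coe_one, Complex.ofReal_one, one_mul, Complex.ofReal_mul, Complex.ofReal_add,
      Complex.ofReal_pow, mul_pow, hsq]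
    ring
  · refine (hint.norm).mono' (Continuous.aestronglyMeasurable ?_) (ae_of_all _ fun p => ?_)
    · exact (continuous_shiftLR ρ S).smul (by fun_prop)
    · rw [norm_smul, Complex.norm_exp_ofReal_mul_I, mul_one]

end Densities

section Risk

open MeasureTheory ProbabilityTheory Matrix

theorem measureReal_withDensity_ofReal {Ω : Type*} [MeasurableSpace Ω] {μ : Measure Ω}
    {f : Ω → ℝ} (hf : Integrable f μ) (h₀ : ∀ x, 0 ≤ f x) {s : Set Ω} (hs : MeasurableSet s) :
    (μ.withDensity fun x => ENNReal.ofReal (f x)).real s = ∫ x in s, f x ∂μ := by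
  rw [measureReal_def, withDensity_apply _ hs,
    ← ofReal_integral_eq_lintegral_ofReal hf.integrableOn (ae_of_all _ h₀),
    ENNReal.toReal_ofReal (integral_nonneg h₀)]

/-- The sum of the two error probabilities is controlled by the second moment of the likelihood
ratio. -/
theorem one_sub_sqrt_le_add_setIntegral {Ω : Type*} [MeasurableSpace Ω] {μ : Measure Ω}
    [IsProbabilityMeasure μ] {L : Ω → ℝ} (hL : Integrable L μ)
    (hL₂ : Integrable (fun x => L x ^ 2) μ) (h₁ : ∫ x, L x ∂μ = 1) {M : ℝ}
    (hM : ∫ x, L x ^ 2 ∂μ ≤ M) {A : Set Ω} (hA : MeasurableSet A) :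
    1 - √(M - 1) / 2 ≤ μ.real Aᶜ + ∫ x in A, L x ∂μ := by
  have hd : Integrable (fun x => 1 - L x) μ := (integrable_const _).sub hL
  have habs : Integrable (fun x => |1 - L x|) μ := hd.abs
  have hsq : Integrable (fun x => (1 - L x) ^ 2) μ := by
    have : Integrable (fun x => 1 - 2 * L x + L x ^ 2) μ :=
      ((integrable_const _).sub (hL.const_mul 2)).add hL₂
    exact this.congr (ae_of_all _ fun x => by ring)
  set m := ∫ x, |1 - L x| ∂μ with hm
  have hvar : m ^ 2 ≤ M - 1 := by
    have h0 : 0 ≤ ∫ x, (|1 - L x| - m) ^ 2 ∂μ := integral_nonneg fun x => sq_nonneg _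
    have h1 : ∫ x, (|1 - L x| - m) ^ 2 ∂μ =
        ∫ x, ((1 - 2 * L x + L x ^ 2) - 2 * m * |1 - L x| + m ^ 2) ∂μ := by
      refine integral_congr_ae (ae_of_all _ fun x => ?_)
      have : |1 - L x| ^ 2 = (1 - L x) ^ 2 := sq_abs _
      dsimp only
      linear_combination this
    rw [h1, integral_add, integral_sub, integral_add, integral_sub, integral_const_mul,
      integral_const_mul, h₁, ← hm] at h0
    · simp only [integral_const, probReal_univ, one_smul] at h0
      linarith
    · exact integrable_const _
    · exact hL.const_mul 2
    · exact (integrable_const _).sub (hL.const_mul 2)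
    · exact hL₂
    · exact ((integrable_const _).sub (hL.const_mul 2)).add hL₂
    · exact habs.const_mul _
    · exact (((integrable_const _).sub (hL.const_mul 2)).add hL₂).sub (habs.const_mul _)
    · exact integrable_const _
  have hm_le : m ≤ √(M - 1) := Real.le_sqrt_of_sq_le hvar
  have hsplit := integral_add_compl hA hd
  rw [integral_sub (integrable_const _) hL, h₁] at hsplit
  have hsplit' := integral_add_compl hA habs
  have hA₁ : ∫ x in A, (1 - L x) ∂μ ≤ ∫ x in A, |1 - L x| ∂μ :=
    integral_mono hd.integrableOn habs.integrableOn fun x => le_abs_self _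
  have hA₂ : -∫ x in Aᶜ, (1 - L x) ∂μ ≤ ∫ x in Aᶜ, |1 - L x| ∂μ := by
    rw [← integral_neg]
    exact integral_mono hd.neg.integrableOn habs.integrableOn fun x => neg_le_abs _
  have hA₃ : ∫ x in A, (1 - L x) ∂μ = μ.real A - ∫ x in A, L x ∂μ := by
    rw [integral_sub (integrable_const _) hL.integrableOn]
    simp
  have hc : μ.real Aᶜ = 1 - μ.real A := probReal_compl_eq_one_sub hA
  simp only [integral_const, probReal_univ, one_smul, sub_self] at hsplit
  linarith

variable {ι : Type*} [Fintype ι] [DecidableEq ι]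

theorem altMeasure_real_eq_integral_prod {ρ : ℝ} (hρ₀ : 0 ≤ ρ) (hρ : ρ < 1) (S : Finset ι)
    {A : Set (EuclideanSpace ℝ ι)} (hA : MeasurableSet A) :
    (altMeasure ρ S).real A = ∫ p, shiftLR ρ S p.1 p.2
      ∂((gaussianReal 0 1).prod ((nullMeasure ι).restrict A)) := by
  rw [altMeasure_eq_map_snd hρ₀ hρ, map_measureReal_apply measurable_snd hA,
    measureReal_withDensity_ofReal (integrable_shiftLR_prod hρ S)
      (fun p => (shiftLR_pos hρ S _ _).le) (measurable_snd hA), ← Set.univ_prod,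
    ← Measure.prod_restrict, Measure.restrict_univ]

theorem integrable_shiftLR_prod_restrict {ρ : ℝ} (hρ : ρ < 1) (S : Finset ι)
    (A : Set (EuclideanSpace ℝ ι)) :
    Integrable (fun p : ℝ × EuclideanSpace ℝ ι => shiftLR ρ S p.1 p.2)
      ((gaussianReal 0 1).prod ((nullMeasure ι).restrict A)) := by
  have h := (integrable_shiftLR_prod hρ S).integrableOn (s := Set.univ ×ˢ A)
  rwa [IntegrableOn, ← Measure.prod_restrict, Measure.restrict_univ] at h

/-- Lower bound on the risk of any test, conditioning on the latent common factor. -/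
theorem le_risk {ρ : ℝ} (hρ₀ : 0 ≤ ρ) (hρ : ρ < 1) {C : Finset (Finset ι)} (hC : C.Nonempty)
    {f : EuclideanSpace ℝ ι → Fin 2} (hf : MeasurableSet {x | f x = 0}) {M : ℝ} {U : Set ℝ}
    (hU : MeasurableSet U)
    (hM : ∀ u ∈ U, ∑ S ∈ C, ∑ T ∈ C, secondMoment ρ u ^ (S ∩ T).card ≤ (C.card : ℝ) ^ 2 * M) :
    (gaussianReal 0 1).real U * (1 - √(M - 1) / 2) ≤ risk ρ C f := by
  set A := {x | f x = 0} with hAdef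
  have hN : (0 : ℝ) < C.card := by exact_mod_cast hC.card_pos
  have hAc : {x | f x = 1} = Aᶜ := by
    ext x
    simp only [hAdef, Set.mem_ofPred_eq, Set.mem_compl_iff]
    generalize f x = b
    revert b
    decide
  let g : ℝ → ℝ := fun u => (nullMeasure ι).real Aᶜ +
    (1 / (C.card : ℝ)) * ∑ S ∈ C, ∫ x in A, shiftLR ρ S u x ∂(nullMeasure ι)
  have hint : ∀ S ∈ C, Integrable (fun u => ∫ x in A, shiftLR ρ S u x ∂(nullMeasure ι))
      (gaussianReal 0 1) := fun S _ => (integrable_shiftLR_prod_restrict hρ S A).integral_prod_left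
  have hg : Integrable g (gaussianReal 0 1) :=
    (integrable_const _).add ((integrable_finsetSum _ hint).const_mul _)
  have hrisk : risk ρ C f = ∫ u, g u ∂(gaussianReal 0 1) := by
    rw [risk, hAc, integral_add (integrable_const _) ((integrable_finsetSum _ hint).const_mul _),
      integral_const_mul, integral_finsetSum _ hint]
    congr 1
    · simp
    · congr 1
      refine Finset.sum_congr rfl fun S _ => ?_
      rw [altMeasure_real_eq_integral_prod hρ₀ hρ S hf,
        integral_prod _ (integrable_shiftLR_prod_restrict hρ S A)]
  have hg₀ : ∀ u, 0 ≤ g u := fun u => add_nonneg measureReal_nonneg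
    (mul_nonneg (by positivity) (Finset.sum_nonneg fun S _ =>
      integral_nonneg fun x => (shiftLR_pos hρ S u x).le))
  have hgU : ∀ u ∈ U, 1 - √(M - 1) / 2 ≤ g u := by
    intro u hu
    have hi : ∀ S ∈ C, Integrable (shiftLR ρ S u) (nullMeasure ι) :=
      fun S _ => integrable_shiftLR hρ S u
    have hsq : ∀ x : EuclideanSpace ℝ ι, (1 / (C.card : ℝ) * ∑ S ∈ C, shiftLR ρ S u x) ^ 2 =
        (1 / (C.card : ℝ)) ^ 2 * ∑ S ∈ C, ∑ T ∈ C, shiftLR ρ S u x * shiftLR ρ T u x := by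
      intro x
      rw [mul_pow, sq (∑ S ∈ C, shiftLR ρ S u x), Finset.sum_mul_sum]
    have hi₂ : ∀ S ∈ C, Integrable (fun x => ∑ T ∈ C, shiftLR ρ S u x * shiftLR ρ T u x)
        (nullMeasure ι) := fun S _ => integrable_finsetSum _ fun T _ =>
          integrable_shiftLR_mul hρ₀ hρ S T u
    have := one_sub_sqrt_le_add_setIntegral (μ := nullMeasure ι)
      (L := fun x => 1 / (C.card : ℝ) * ∑ S ∈ C, shiftLR ρ S u x)
      ((integrable_finsetSum _ hi).const_mul _)
      (by simp_rw [hsq]; exact (integrable_finsetSum _ hi₂).const_mul _)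
      (by
        rw [integral_const_mul, integral_finsetSum _ hi,
          Finset.sum_congr rfl fun S _ => integral_shiftLR hρ S u]
        simp [hN.ne'])
      (M := M)
      (by
        simp_rw [hsq]
        rw [integral_const_mul, integral_finsetSum _ hi₂, Finset.sum_congr rfl fun S _ =>
          (integral_finsetSum _ fun T _ => integrable_shiftLR_mul hρ₀ hρ S T u).trans
            (Finset.sum_congr rfl fun T _ => integral_shiftLR_mul hρ₀ hρ S T u),
          one_div, inv_pow, inv_mul_le_iff₀ (by positivity)]
        exact hM u hu) hf
    rwa [integral_const_mul, integral_finsetSum _ fun S hS => (hi S hS).integrableOn] at this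
  rw [hrisk]
  calc (gaussianReal 0 1).real U * (1 - √(M - 1) / 2)
      = ∫ _u in U, (1 - √(M - 1) / 2) ∂(gaussianReal 0 1) := by simp
    _ ≤ ∫ u in U, g u ∂(gaussianReal 0 1) :=
        setIntegral_mono_on (integrable_const _).integrableOn hg.integrableOn hU hgU
    _ ≤ ∫ u, g u ∂(gaussianReal 0 1) := setIntegral_le_integral hg (ae_of_all _ hg₀)

theorem covMat_inv {ρ : ℝ} (hρ₀ : 0 ≤ ρ) (hρ : ρ < 1) (S : Finset ι) : (covMat ρ S)⁻¹ =
    diagonal (fun i => if i ∈ S then (1 - ρ)⁻¹ else 1) -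
      (ρ / ((1 - ρ) * (1 - ρ + S.card * ρ))) •
        vecMulVec (fun i => if i ∈ S then 1 else 0) (fun i => if i ∈ S then 1 else 0) := by
  have h1 : 0 < 1 - ρ := by linarith
  have h2 : 0 < 1 - ρ + S.card * ρ := by positivity
  refine inv_eq_right_inv ?_
  set v : ι → ℝ := fun i => if i ∈ S then 1 else 0 with hv
  have hvv : v ⬝ᵥ v = S.card := by simp [hv, dotProduct]
  have hd : diagonal (fun i => if i ∈ S then 1 - ρ else 1) * vecMulVec v v =
      (1 - ρ) • vecMulVec v v := by
    ext i j
    rw [diagonal_mul, Matrix.smul_apply, vecMulVec_apply]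
    by_cases hi : i ∈ S <;> simp [hv, hi]
  have hd' : vecMulVec v v * diagonal (fun i => if i ∈ S then (1 - ρ)⁻¹ else 1) =
      (1 - ρ)⁻¹ • vecMulVec v v := by
    ext i j
    rw [mul_diagonal, Matrix.smul_apply, vecMulVec_apply]
    by_cases hi : j ∈ S <;> simp [hv, hi]
  have hdd : diagonal (fun i => if i ∈ S then 1 - ρ else 1) *
      diagonal (fun i => if i ∈ S then (1 - ρ)⁻¹ else 1) = (1 : Matrix ι ι ℝ) := by
    rw [diagonal_mul_diagonal, ← diagonal_one]
    congr 1
    ext i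
    split_ifs
    exacts [mul_inv_cancel₀ h1.ne', one_mul _]
  have hvv' : vecMulVec v v * vecMulVec v v = (S.card : ℝ) • vecMulVec v v := by
    rw [vecMulVec_mul_vecMulVec, hvv, vecMulVec_smul]
  rw [covMat_eq, ← hv, add_mul, mul_sub, mul_sub, hdd, mul_smul_comm, hd, smul_mul_assoc, hd',
    smul_mul_assoc, mul_smul_comm, hvv']
  simp only [smul_smul]
  rw [sub_add, sub_eq_self, sub_sub_eq_add_sub, ← add_smul, ← sub_smul]
  convert! zero_smul ℝ _
  field_simp
  ring

theorem Zstat_eq {ρ : ℝ} (hρ₀ : 0 ≤ ρ) (hρ : ρ < 1) (S : Finset ι) (x : EuclideanSpace ℝ ι) :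
    Zstat ρ S x = Real.exp ((1 / 2) * ((1 - (1 - ρ)⁻¹) * ∑ i ∈ S, x i ^ 2 +
      ρ / ((1 - ρ) * (1 - ρ + S.card * ρ)) * (∑ i ∈ S, x i) ^ 2)) := by
  rw [Zstat, covMat_inv hρ₀ hρ, sub_mulVec, sub_mulVec, smul_mulVec, vecMulVec_mulVec,
    dotProduct_sub, dotProduct_sub, dotProduct_smul]
  congr 2
  rw [← sub_add]
  congr 1
  · rw [one_mulVec, ← dotProduct_sub, dotProduct, Finset.mul_sum, ← Finset.univ_inter S,
      ← Finset.sum_ite_mem]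
    refine Finset.sum_congr rfl fun i _ => ?_
    rw [Pi.sub_apply, mulVec_diagonal, Finset.univ_inter]
    split_ifs <;> ring
  · simp [dotProduct, sq, ← Finset.sum_mul]

theorem continuous_Zstat (ρ : ℝ) (S : Finset ι) : Continuous (Zstat ρ S) := by
  unfold Zstat
  simp only [dotProduct, mulVec]
  fun_prop

/-- The ratio of the density of `P_S` to `Zstat`, where `n` is the cardinality of `S`. -/
def mixtureConst (ρ : ℝ) (n : ℕ) : ℝ := (√(1 - ρ))⁻¹ ^ n * √((1 - ρ) / (1 - ρ + n * ρ))

theorem gaussianPDFReal_mul_shiftLR {ρ : ℝ} (hρ₀ : 0 ≤ ρ) (hρ : ρ < 1) (S : Finset ι)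
    (x : EuclideanSpace ℝ ι) (u : ℝ) :
    gaussianPDFReal 0 1 u * shiftLR ρ S u x = mixtureConst ρ S.card * Zstat ρ S x *
      gaussianPDFReal (√ρ * (∑ i ∈ S, x i) / (1 - ρ + S.card * ρ))
        (Real.toNNReal ((1 - ρ) / (1 - ρ + S.card * ρ))) u := by
  have h1 : 0 < 1 - ρ := by linarith
  have h2 : 0 < 1 - ρ + S.card * ρ := by positivity
  have hsq : √ρ ^ 2 = ρ := Real.sq_sqrt hρ₀
  have hv : 0 < √((1 - ρ) / (1 - ρ + S.card * ρ)) := Real.sqrt_pos.2 (by positivity)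
  rw [Zstat_eq hρ₀ hρ, shiftLR, mixtureConst, gaussianPDFReal, gaussianPDFReal]
  simp only [coordLR]
  rw [Finset.prod_mul_distrib, Finset.prod_const, ← Real.exp_sum, Real.coe_toNNReal _ (by positivity),
    Real.sqrt_mul (by positivity) ((1 - ρ) / (1 - ρ + S.card * ρ)), mul_inv, NNReal.coe_one,
    mul_one]
  have hsum : ∑ i ∈ S, (x i ^ 2 / 2 - (x i - √ρ * u) ^ 2 / (2 * (1 - ρ))) =
      (∑ i ∈ S, x i ^ 2) / 2 - ((∑ i ∈ S, x i ^ 2) - 2 * √ρ * u * (∑ i ∈ S, x i) +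
        S.card * (ρ * u ^ 2)) / (2 * (1 - ρ)) := by
    rw [Finset.sum_sub_distrib, ← Finset.sum_div, ← Finset.sum_div]
    congr 2
    rw [Finset.mul_sum, ← Finset.sum_sub_distrib, ← nsmul_eq_mul, ← Finset.sum_const,
      ← Finset.sum_add_distrib]
    refine Finset.sum_congr rfl fun i _ => ?_
    linear_combination u ^ 2 * hsq
  rw [hsum]
  generalize (∑ i ∈ S, x i ^ 2) = Q
  generalize (∑ i ∈ S, x i) = s
  have hexp : Real.exp (-(u - 0) ^ 2 / 2) * Real.exp (Q / 2 - (Q - 2 * √ρ * u * s +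
        S.card * (ρ * u ^ 2)) / (2 * (1 - ρ))) =
      Real.exp ((1 / 2) * ((1 - (1 - ρ)⁻¹) * Q +
        ρ / ((1 - ρ) * (1 - ρ + S.card * ρ)) * s ^ 2)) *
      Real.exp (-(u - √ρ * s / (1 - ρ + S.card * ρ)) ^ 2 /
        (2 * ((1 - ρ) / (1 - ρ + S.card * ρ)))) := by
    rw [← Real.exp_add, ← Real.exp_add]
    congr 1
    field_simp
    ring_nf
    rw [hsq]
    ring
  calc _ = (√(2 * Real.pi))⁻¹ * (√(1 - ρ))⁻¹ ^ S.card * (Real.exp (-(u - 0) ^ 2 / 2) *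
      Real.exp (Q / 2 - (Q - 2 * √ρ * u * s + S.card * (ρ * u ^ 2)) / (2 * (1 - ρ)))) := by ring_nf
    _ = _ := by
      rw [hexp]
      field_simp

theorem integral_shiftLR_gaussianReal {ρ : ℝ} (hρ₀ : 0 ≤ ρ) (hρ : ρ < 1) (S : Finset ι)
    (x : EuclideanSpace ℝ ι) :
    ∫ u, shiftLR ρ S u x ∂(gaussianReal 0 1) = mixtureConst ρ S.card * Zstat ρ S x := by
  have h1 : 0 < 1 - ρ := by linarith
  have hv : 0 < (1 - ρ) / (1 - ρ + S.card * ρ) := by positivity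
  rw [integral_gaussianReal_eq_integral_smul one_ne_zero]
  simp_rw [smul_eq_mul, gaussianPDFReal_mul_shiftLR hρ₀ hρ]
  rw [integral_const_mul, integral_gaussianPDFReal_eq_one _ (by simpa using hv), mul_one]

theorem altMeasure_real_eq_mixtureConst_mul {ρ : ℝ} (hρ₀ : 0 ≤ ρ) (hρ : ρ < 1) (S : Finset ι)
    {A : Set (EuclideanSpace ℝ ι)} (hA : MeasurableSet A) :
    (altMeasure ρ S).real A =
      mixtureConst ρ S.card * ∫ x in A, Zstat ρ S x ∂(nullMeasure ι) := by
  rw [altMeasure_real_eq_integral_prod hρ₀ hρ S hA,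
    integral_prod_symm _ (integrable_shiftLR_prod_restrict hρ S A), ← integral_const_mul]
  simp_rw [integral_shiftLR_gaussianReal hρ₀ hρ]

theorem mixtureConst_mul_integral {ρ : ℝ} (hρ₀ : 0 ≤ ρ) (hρ : ρ < 1) (S : Finset ι) :
    mixtureConst ρ S.card * ∫ x, Zstat ρ S x ∂(nullMeasure ι) = 1 := by
  have h := altMeasure_real_eq_mixtureConst_mul hρ₀ hρ S MeasurableSet.univ
  have : IsProbabilityMeasure (altMeasure ρ S) := by unfold altMeasure; infer_instance
  rw [probReal_univ, Measure.restrict_univ] at h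
  exact h.symm

theorem integrable_Zstat {ρ : ℝ} (hρ₀ : 0 ≤ ρ) (hρ : ρ < 1) (S : Finset ι) :
    Integrable (Zstat ρ S) (nullMeasure ι) := by
  by_contra h
  have := mixtureConst_mul_integral hρ₀ hρ S
  rw [integral_undef h] at this
  simp at this

/-- `Z_S / E₀ Z_S` is the density of `P_S` with respect to `P₀`. -/
theorem altMeasure_real_eq {ρ : ℝ} (hρ₀ : 0 ≤ ρ) (hρ : ρ < 1) (S : Finset ι)
    {A : Set (EuclideanSpace ℝ ι)} (hA : MeasurableSet A) :
    (altMeasure ρ S).real A =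
      ∫ x in A, Zstat ρ S x / ∫ y, Zstat ρ S y ∂(nullMeasure ι) ∂(nullMeasure ι) := by
  rw [altMeasure_real_eq_mixtureConst_mul hρ₀ hρ S hA, integral_div,
    eq_one_div_of_mul_eq_one_left (mixtureConst_mul_integral hρ₀ hρ S)]
  ring

theorem measurableSet_lrTest_eq_zero (ρ : ℝ) (C : Finset (Finset ι)) :
    MeasurableSet {x | lrTest ρ C x = 0} := by
  have h : {x | lrTest ρ C x = 0} = {x | likelihoodRatio ρ C x ≤ 1} := by
    ext x
    simp only [lrTest, Set.mem_ofPred_eq]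
    split_ifs with h <;> simp [h]
  rw [h]
  refine measurableSet_le (Continuous.measurable ?_) measurable_const
  unfold likelihoodRatio
  exact continuous_const.mul
    (continuous_finsetSum _ fun S _ => (continuous_Zstat ρ S).div_const _)

theorem bayesRisk_le_one {ρ : ℝ} (hρ₀ : 0 ≤ ρ) (hρ : ρ < 1) (C : Finset (Finset ι)) :
    bayesRisk ρ C ≤ 1 := by
  set A := {x | lrTest ρ C x = 0} with hAdef
  have hA : MeasurableSet A := measurableSet_lrTest_eq_zero ρ C
  have hAc : {x | lrTest ρ C x = 1} = Aᶜ := by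
    ext x
    simp only [hAdef, Set.mem_ofPred_eq, Set.mem_compl_iff]
    generalize lrTest ρ C x = b
    revert b
    decide
  have hint : ∀ S ∈ C, Integrable
      (fun x => Zstat ρ S x / ∫ y, Zstat ρ S y ∂(nullMeasure ι)) (nullMeasure ι) :=
    fun S _ => (integrable_Zstat hρ₀ hρ S).div_const _
  have hL : Integrable (likelihoodRatio ρ C) (nullMeasure ι) :=
    (integrable_finsetSum _ hint).const_mul _
  have hsum : (1 / (C.card : ℝ)) * ∑ S ∈ C, (altMeasure ρ S).real A =
      ∫ x in A, likelihoodRatio ρ C x ∂(nullMeasure ι) := by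
    rw [Finset.sum_congr rfl fun S _ => altMeasure_real_eq hρ₀ hρ S hA,
      ← integral_finsetSum _ fun S hS => (hint S hS).integrableOn, ← integral_const_mul]
    rfl
  have hle : ∫ x in A, likelihoodRatio ρ C x ∂(nullMeasure ι) ≤ (nullMeasure ι).real A := by
    calc _ ≤ ∫ _x in A, (1 : ℝ) ∂(nullMeasure ι) := by
          refine setIntegral_mono_on hL.integrableOn (integrable_const _).integrableOn hA ?_
          intro x hx
          by_contra h
          have hx' : lrTest ρ C x = 0 := hx
          rw [lrTest, if_neg h] at hx'
          exact one_ne_zero hx'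
      _ = _ := by simp
  rw [bayesRisk, risk, hAc, hsum, probReal_compl_eq_one_sub hA]
  linarith

end Risk

section Bounds

open MeasureTheory ProbabilityTheory

theorem one_le_secondMoment {ρ : ℝ} (hρ₀ : 0 ≤ ρ) (hρ : ρ < 1) (u : ℝ) :
    1 ≤ secondMoment ρ u := by
  have h : 0 < √(1 - ρ ^ 2) := Real.sqrt_pos.2 (by nlinarith)
  rw [secondMoment, le_div_iff₀ h, one_mul]
  calc √(1 - ρ ^ 2) ≤ 1 := Real.sqrt_le_one.2 (by nlinarith)
    _ ≤ _ := Real.one_le_exp (by positivity)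

theorem secondMoment_mono {ρ u a : ℝ} (hρ₀ : 0 ≤ ρ) (hu : u ∈ Set.Icc (-a) a) :
    secondMoment ρ u ≤ secondMoment ρ a := by
  have : u ^ 2 ≤ a ^ 2 := sq_le_sq' hu.1 hu.2
  unfold secondMoment
  gcongr

theorem le_risk_spanningTrees {ρ : ℝ} (hρ₀ : 0 ≤ ρ) (hρ : ρ < 1) (k : ℕ) [DecidableEq (Edge k)]
    {f : EuclideanSpace ℝ (Edge k) → Fin 2} (hf : MeasurableSet {x | f x = 0}) (a : ℝ) :
    (gaussianReal 0 1).real (Set.Icc (-a) a) *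
      (1 - √(Real.exp (2 * (secondMoment ρ a - 1)) - 1) / 2) ≤ risk ρ (spanningTrees k) f := by
  refine le_risk hρ₀ hρ (spanningTrees_nonempty k) hf measurableSet_Icc fun u hu => ?_
  rw [Finset.sum_comm]
  calc ∑ T ∈ spanningTrees k, ∑ S ∈ spanningTrees k, secondMoment ρ u ^ (S ∩ T).card
      ≤ ∑ T ∈ spanningTrees k, (spanningTrees k).card *
          Real.exp (2 * (secondMoment ρ a - 1)) := by
        refine Finset.sum_le_sum fun T hT => ?_
        refine le_trans (Finset.sum_le_sum fun S _ => ?_)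
          (sum_pow_card_inter_le (sub_nonneg.2 (one_le_secondMoment hρ₀ hρ a)) hT)
        rw [add_sub_cancel]
        exact pow_le_pow_left₀ (secondMoment_pos hρ₀ hρ u).le (secondMoment_mono hρ₀ hu) _
    _ = _ := by
        rw [Finset.sum_const, nsmul_eq_mul]
        ring

theorem secondMoment_one_le {ρ : ℝ} (hρ₀ : 0 ≤ ρ) (hρ : ρ ≤ 0.4) : secondMoment ρ 1 ≤ 3 / 2 := by
  have h : 0 < √(1 - ρ ^ 2) := Real.sqrt_pos.2 (by nlinarith)
  have hexp : Real.exp (2 / 7) ≤ 1.36 := by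
    refine le_of_pow_le_pow_left₀ (n := 7) (by norm_num) (by norm_num) ?_
    rw [← Real.exp_nat_mul]
    calc Real.exp ((7 : ℕ) * (2 / 7)) = Real.exp 1 ^ 2 := by
          rw [← Real.exp_nat_mul]; norm_num
      _ ≤ 2.7182818286 ^ 2 := by gcongr; exact Real.exp_one_lt_d9.le
      _ ≤ 1.36 ^ 7 := by norm_num
  have hsqrt : 0.91 ≤ √(1 - ρ ^ 2) := Real.le_sqrt_of_sq_le (by nlinarith)
  rw [secondMoment, div_le_iff₀ h]
  calc Real.exp (ρ * 1 ^ 2 / (1 + ρ)) ≤ Real.exp (2 / 7) := by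
        refine Real.exp_le_exp.2 ?_
        rw [div_le_div_iff₀ (by linarith) (by norm_num)]
        linarith
    _ ≤ 1.36 := hexp
    _ ≤ 3 / 2 * 0.91 := by norm_num
    _ ≤ _ := by gcongr

theorem le_gaussianReal_Icc_one : 0.48 ≤ (gaussianReal 0 1).real (Set.Icc (-1) 1) := by
  have hpdf : ∀ s ∈ Set.Icc (-1 : ℝ) 1, 0.24 ≤ gaussianPDFReal 0 1 s := by
    intro s hs
    have hs' : s ^ 2 ≤ 1 := by nlinarith [hs.1, hs.2]
    have hsq : √(2 * Real.pi) ≤ 2.507 := by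
      rw [Real.sqrt_le_left (by norm_num)]
      nlinarith [Real.pi_lt_d4]
    have hexp : Real.exp (1 / 2) ≤ 1.649 := by
      refine le_of_pow_le_pow_left₀ (n := 2) (by norm_num) (by norm_num) ?_
      rw [← Real.exp_nat_mul]
      norm_num
      linarith [Real.exp_one_lt_d9]
    calc (0.24 : ℝ) ≤ (2.507 : ℝ)⁻¹ * (1.649 : ℝ)⁻¹ := by norm_num
      _ ≤ (√(2 * Real.pi))⁻¹ * (Real.exp (1 / 2))⁻¹ := by gcongr
      _ ≤ gaussianPDFReal 0 1 s := by
        rw [gaussianPDFReal, NNReal.coe_one, mul_one, ← Real.exp_neg]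
        gcongr
        linarith
  rw [measureReal_def, gaussianReal_apply_eq_integral _ one_ne_zero,
    ENNReal.toReal_ofReal (integral_nonneg fun s => gaussianPDFReal_nonneg 0 1 s)]
  calc (0.48 : ℝ) = ∫ _s in Set.Icc (-1 : ℝ) 1, (0.24 : ℝ) := by
        simp [measureReal_def]
        norm_num
    _ ≤ _ := setIntegral_mono_on (integrableOn_const (by simp))
        (integrable_gaussianPDFReal 0 1).integrableOn measurableSet_Icc hpdf

theorem exists_lt_gaussianReal_Icc {c : ℝ} (hc : c < 1) :
    ∃ a : ℝ, c < (gaussianReal 0 1).real (Set.Icc (-a) a) := by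
  have hmono : Monotone fun n : ℕ => Set.Icc (-(n : ℝ)) n := fun m n hmn =>
    Set.Icc_subset_Icc (neg_le_neg (by exact_mod_cast hmn)) (by exact_mod_cast hmn)
  have hU : ⋃ n : ℕ, Set.Icc (-(n : ℝ)) n = Set.univ := by
    refine Set.eq_univ_of_forall fun x => ?_
    obtain ⟨n, hn⟩ := exists_nat_ge |x|
    exact Set.mem_iUnion.2 ⟨n, abs_le.1 hn⟩
  have h := tendsto_measure_iUnion_atTop (μ := gaussianReal 0 1) hmono
  rw [hU, measure_univ] at h
  have h' := (ENNReal.tendsto_toReal ENNReal.one_ne_top).comp h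
  obtain ⟨n, hn⟩ := (h'.eventually_const_lt (by simpa using hc)).exists
  exact ⟨n, hn⟩

theorem le_bayesRisk_spanningTrees (k : ℕ) (ρ : ℝ) (hρ₀ : 0 < ρ) (hρ : ρ ≤ 0.4) :
    0.15 ≤ bayesRisk ρ (spanningTrees k) := by
  have hρ' : ρ < 1 := by norm_num at hρ; linarith
  refine le_trans ?_
    (le_risk_spanningTrees hρ₀.le hρ' k (measurableSet_lrTest_eq_zero ρ _) 1)
  have hM : √(Real.exp (2 * (secondMoment ρ 1 - 1)) - 1) ≤ 1.32 := by
    rw [Real.sqrt_le_left (by norm_num)]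
    have : Real.exp (2 * (secondMoment ρ 1 - 1)) ≤ Real.exp 1 :=
      Real.exp_le_exp.2 (by linarith [secondMoment_one_le hρ₀.le hρ])
    norm_num
    linarith [Real.exp_one_lt_d9]
  calc (0.15 : ℝ) ≤ 0.48 * (1 - 1.32 / 2) := by norm_num
    _ ≤ _ := by
      refine mul_le_mul le_gaussianReal_Icc_one (by linarith) (by norm_num) measureReal_nonneg

theorem bayesRisk_spanningTrees_tendsto_one (ε : ℝ) (hε : 0 < ε) :
    ∃ δ : ℝ, 0 < δ ∧ ∀ (k : ℕ) (ρ : ℝ), 0 < ρ → ρ < δ →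
      |bayesRisk ρ (spanningTrees k) - 1| < ε := by
  obtain ⟨a, ha⟩ := exists_lt_gaussianReal_Icc (c := 1 - ε) (by linarith)
  have hcont : ContinuousAt (fun ρ : ℝ => (gaussianReal 0 1).real (Set.Icc (-a) a) *
      (1 - √(Real.exp (2 * (secondMoment ρ a - 1)) - 1) / 2)) 0 := by
    unfold secondMoment
    fun_prop (disch := simp)
  have hev := hcont.eventually (lt_mem_nhds (a := 1 - ε) (by simpa [secondMoment] using ha))
  obtain ⟨δ, hδ, hball⟩ := Metric.eventually_nhds_iff.1 hev
  refine ⟨min δ 1, lt_min hδ one_pos, fun k ρ hρ₀ hρ => ?_⟩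
  have hρ' : ρ < 1 := hρ.trans_le (min_le_right _ _)
  have hlow : _ ≤ bayesRisk ρ (spanningTrees k) :=
    le_risk_spanningTrees hρ₀.le hρ' k (measurableSet_lrTest_eq_zero ρ _) a
  have hb := hball (y := ρ) (by
    rw [Real.dist_eq, sub_zero, abs_of_pos hρ₀]; exact hρ.trans_le (min_le_left _ _))
  have hup := bayesRisk_le_one hρ₀.le hρ' (spanningTrees k)
  rw [abs_lt]
  exact ⟨by linarith, by linarith⟩

end Bounds

end CorrelationDetection

end

theorem corollary2p5 :
    (∀ (k : ℕ) (ρ : ℝ), 0 < ρ → ρ ≤ 0.4 →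
      0.15 ≤ CorrelationDetection.bayesRisk ρ (CorrelationDetection.spanningTrees k)) ∧
    (∀ ε : ℝ, 0 < ε → ∃ δ : ℝ, 0 < δ ∧ ∀ (k : ℕ) (ρ : ℝ), 0 < ρ → ρ < δ →
      |CorrelationDetection.bayesRisk ρ (CorrelationDetection.spanningTrees k) - 1| < ε) :=
  ⟨CorrelationDetection.le_bayesRisk_spanningTrees,
    CorrelationDetection.bayesRisk_spanningTrees_tendsto_one⟩
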